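/- For $f:\mathbb{R}^n\to\mathbb{R}^q$ locally Lipschitz, a set-valued map $J:\mathbb{R}^n\rightrightarrows\mathbb{R}^{q\times n}$ is called a conservative Jacobian for $f$ if $J$ has nonempty values and a closed graph, is locally bounded, and for every absolutely continuous path $\gamma:[0,1]\to\mathbb{R}^n$ one has, for almost every $t\in[0,1]$, $\frac{d}{dt}f(\gamma(t))=V\dot\gamma(t)$ for all $V\in J(\gamma(t))$ (in particular, both derivatives exist); $f$ is path differentiable if it has a conservative Jacobian. Let $F:\mathbb{R}^p\times\mathbb{R}^m\to\mathbb{R}^p$ be locally Lipschitz and path differentiable, jointly in $(x,\theta)$, and let $J_F:\mathbb{R}^p\times\mathbb{R}^m\rightrightarrows\mathbb{R}^{p\times(p+m)}$ be a conservative Jacobian for $F$. Assume that there is $0\le\rho<1$ such that, for all $(x,\theta)$ and all $[A,B]\in J_F(x,\theta)$ with $A\in\mathbb{R}^{p\times p}$ and $B\in\mathbb{R}^{p\times m}$, the (Euclidean) operator norm of $A$ is at most $\rho$. Then: (i) for every $\theta\in\mathbb{R}^m$ the map $F(\cdot,\theta)$ has a unique fixed point $\bar x(\theta)$; (ii) for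 every $\theta\in\mathbb{R}^m$ the set $J_F(\bar x(\theta),\theta)$ is compact and there is a unique nonempty compact set $K\subset\mathbb{R}^{p\times m}$ such that $K=\{AX+B:\ [A,B]\in J_F(\bar x(\theta),\theta),\ X\in K\}$; denote it by $J^{\mathrm{alg}}_{\bar x}(\theta)=\mathrm{fix}[J_F(\bar x(\theta),\theta)]$; (iii) $\bar x$ is locally Lipschitz and $J^{\mathrm{alg}}_{\bar x}$ is a conservative Jacobian for $\bar x$. -/

import Mathlib

open Set Filter Topology MeasureTheory

namespace Piggyback

section Conservative

variable {E G : Type*} [NormedAddCommGroup E] [NormedSpace ℝ E]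
  [NormedAddCommGroup G] [NormedSpace ℝ G]

/-- A set-valued map `J` is locally bounded if every point has a neighbourhood on which the
values of `J` stay in a common bounded set. -/
def LocallyBounded (J : E → Set (E →L[ℝ] G)) : Prop :=
  ∀ x : E, ∃ U ∈ 𝓝 x, Bornology.IsBounded (⋃ y ∈ U, J y)

/-- `J` is a conservative Jacobian for the locally Lipschitz map `f`.  Jacobian matrices are
regarded as linear maps.  The chain rule has to hold, for almost every `t ∈ [0, 1]`, for every
element of `J (γ t)` at once, along every absolutely continuous path `γ` on `[0, 1]` (the values
of `γ` outside `[0, 1]` play no role). -/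
structure IsConservativeJacobian (f : E → G) (J : E → Set (E →L[ℝ] G)) : Prop where
  locallyLipschitz : LocallyLipschitz f
  nonempty : ∀ x, (J x).Nonempty
  isClosed_graph : IsClosed {q : E × (E →L[ℝ] G) | q.2 ∈ J q.1}
  locallyBounded : LocallyBounded J
  chain_rule : ∀ γ : ℝ → E, AbsolutelyContinuousOnInterval γ 0 1 →
    ∀ᵐ t ∂(volume.restrict (Icc (0 : ℝ) 1)),
      DifferentiableAt ℝ γ t ∧
        ∀ V ∈ J (γ t), HasDerivAt (fun s => f (γ s)) (V (deriv γ t)) t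

end Conservative

section FixedPoint

variable {X Θ : Type*} [NormedAddCommGroup X] [NormedSpace ℝ X]
  [NormedAddCommGroup Θ] [NormedSpace ℝ Θ]

/-- The block `A` of `M = [A, B]`. -/
def blockA (M : X × Θ →L[ℝ] X) : X →L[ℝ] X := M.comp (ContinuousLinearMap.inl ℝ X Θ)

/-- The block `B` of `M = [A, B]`. -/
def blockB (M : X × Θ →L[ℝ] X) : Θ →L[ℝ] X := M.comp (ContinuousLinearMap.inr ℝ X Θ)

/-- The action `𝒥(𝒳) = {A L + B : [A, B] ∈ 𝒥, L ∈ 𝒳}`. -/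
def act (𝒥 : Set (X × Θ →L[ℝ] X)) (𝒳 : Set (Θ →L[ℝ] X)) : Set (Θ →L[ℝ] X) :=
  {N | ∃ M ∈ 𝒥, ∃ L ∈ 𝒳, N = (blockA M).comp L + blockB M}

/-- `K` is a nonempty compact set with `K = 𝒥(K)`. -/
def IsFixSet (𝒥 : Set (X × Θ →L[ℝ] X)) (K : Set (Θ →L[ℝ] X)) : Prop :=
  K.Nonempty ∧ IsCompact K ∧ K = act 𝒥 K

/-- `fix(𝒥)`: the nonempty compact set `K` with `K = 𝒥(K)`
(meaningful when there is exactly one). -/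
noncomputable def fixSet (𝒥 : Set (X × Θ →L[ℝ] X)) : Set (Θ →L[ℝ] X) :=
  Classical.epsilon (IsFixSet 𝒥)

/-- `x̄(θ)`: the fixed point of `F(·, θ)` (meaningful when there is exactly one). -/
noncomputable def fixedPointMap (F : X × Θ → X) (θ : Θ) : X :=
  Classical.epsilon (fun x => F (x, θ) = x)

/-- `J^alg(θ) = fix[J_F(x̄(θ), θ)]`. -/
noncomputable def algJacobian (F : X × Θ → X) (JF : X × Θ → Set (X × Θ →L[ℝ] X)) (θ : Θ) :
    Set (Θ →L[ℝ] X) :=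
  fixSet (JF (fixedPointMap F θ, θ))

end FixedPoint

end Piggyback

/-! Everything rests on one scalar fact, `nonpos_of_forall_exists_le_mul`: a function bounded above
on a set, whose value at each point is at most `ρ < 1` times its value at some other point of the
set, is nonpositive. Applied to the distance to `K`, it shows that a fixed set contains every
bounded `S ⊆ act 𝒥 S`. This gives uniqueness, and the closed graph as well. Existence is of
Knaster–Tarski type: the union of all such `S` is fixed. Integrating the chain rule along segments
makes `F(·, θ)` a `ρ`-contraction, hence a unique fixed point, locally Lipschitz in `θ`. For the
chain rule, put `x = g ∘ γ`. Differentiating `F(x, γ) = x` gives `x' = A x' + B γ'` for every `[A,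
B]` in `J_F`. The scalar fact applied to `‖L γ' - x'‖` then gives `L γ' = x'` for every `L` in the
fixed set. -/

open scoped NNReal

/-! ### Absolutely continuous curves -/

section AbsolutelyContinuous

variable {α β : Type*} [PseudoMetricSpace α] [PseudoMetricSpace β] {a b : ℝ}

open AbsolutelyContinuousOnInterval in
theorem LipschitzOnWith.comp_absolutelyContinuousOnInterval {K : ℝ≥0} {g : α → β} {f : ℝ → α}
    (hg : LipschitzOnWith K g (f '' uIcc a b)) (hf : AbsolutelyContinuousOnInterval f a b) :
    AbsolutelyContinuousOnInterval (fun t => g (f t)) a b := by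
  rw [absolutelyContinuousOnInterval_iff] at hf ⊢
  intro ε hε
  obtain ⟨δ, hδ, h⟩ := hf (ε / (K + 1)) (by positivity)
  refine ⟨δ, hδ, fun I hI hlen => ?_⟩
  have h1 := h I hI hlen
  rw [lt_div_iff₀ (by positivity), Finset.sum_mul] at h1
  refine lt_of_le_of_lt (Finset.sum_le_sum fun i hi => ?_) h1
  have h2 := hg.dist_le_mul _ (mem_image_of_mem f (hI.1 i hi).1) _ (mem_image_of_mem f (hI.1 i hi).2)
  rw [mul_add, mul_one, mul_comm]
  exact h2.trans (le_add_of_nonneg_right dist_nonneg)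

theorem LocallyLipschitz.comp_absolutelyContinuousOnInterval {V : Type*}
    [SeminormedAddCommGroup V] {g : V → β} {f : ℝ → V}
    (hg : LocallyLipschitz g) (hf : AbsolutelyContinuousOnInterval f a b) :
    AbsolutelyContinuousOnInterval (fun t => g (f t)) a b := by
  obtain ⟨K, hK⟩ := hg.locallyLipschitzOn.exists_lipschitzOnWith_of_compact
    (isCompact_uIcc.image_of_continuousOn hf.continuousOn)
  exact hK.comp_absolutelyContinuousOnInterval hf

theorem AbsolutelyContinuousOnInterval.prodMk {f : ℝ → α} {g : ℝ → β}
    (hf : AbsolutelyContinuousOnInterval f a b) (hg : AbsolutelyContinuousOnInterval g a b) :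
    AbsolutelyContinuousOnInterval (fun t => (f t, g t)) a b := by
  apply squeeze_zero (fun I => Finset.sum_nonneg fun i _ => dist_nonneg) (fun I => ?_)
    (by simpa using Tendsto.add hf hg)
  rw [← Finset.sum_add_distrib]
  gcongr
  exact max_le_add_of_nonneg dist_nonneg dist_nonneg

end AbsolutelyContinuous

/-- A mean value inequality for absolutely continuous curves in an inner product space. -/
theorem AbsolutelyContinuousOnInterval.norm_sub_le_of_ae_hasDerivAt {V : Type*}
    [NormedAddCommGroup V] [InnerProductSpace ℝ V] {f : ℝ → V} {C : ℝ}
    (hf : AbsolutelyContinuousOnInterval f 0 1)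
    (h : ∀ᵐ t ∂(volume.restrict (Icc (0 : ℝ) 1)), ∃ v, HasDerivAt f v t ∧ ‖v‖ ≤ C) :
    ‖f 1 - f 0‖ ≤ C := by
  -- Pairing with the increment itself reduces the claim to the scalar fundamental theorem of
  -- calculus.
  set w := f 1 - f 0 with hw
  have hlip : LocallyLipschitz (fun y : V => inner ℝ w y) :=
    ((innerSL ℝ w).lipschitz).locallyLipschitz
  have hac := hlip.comp_absolutelyContinuousOnInterval hf
  have hint := hac.integral_deriv_eq_sub
  have hae : ∀ᵐ t : ℝ, t ∈ uIoc (0 : ℝ) 1 → ‖deriv (fun t => inner ℝ w (f t)) t‖ ≤ ‖w‖ * C := by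
    rw [ae_restrict_iff' measurableSet_Icc] at h
    filter_upwards [h] with t ht htI
    rw [uIoc_of_le zero_le_one] at htI
    obtain ⟨v, hv, hvC⟩ := ht (Ioc_subset_Icc_self htI)
    have hd : HasDerivAt (fun t => inner ℝ w (f t)) (inner ℝ w v) t :=
      (innerSL ℝ w).hasFDerivAt.comp_hasDerivAt t hv
    rw [hd.deriv]
    exact (norm_inner_le_norm w v).trans (by gcongr)
  have hle := intervalIntegral.norm_integral_le_of_norm_le_const_ae hae
  rw [hint, ← inner_sub_right, ← hw, real_inner_self_eq_norm_sq] at hle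
  simp only [norm_pow, norm_norm, sub_zero, abs_one, mul_one] at hle
  rcases (norm_nonneg w).eq_or_lt with h0 | h0
  · have : w = 0 := norm_eq_zero.1 h0.symm
    -- Here `0 ≤ C` must be extracted from one point where the derivative bound holds.
    obtain ⟨t, v, -, hv⟩ : ∃ t v, HasDerivAt f v t ∧ ‖v‖ ≤ C := by
      have : (ae (volume.restrict (Icc (0 : ℝ) 1))).NeBot := by
        rw [ae_neBot]
        intro h0
        simpa using congrArg (fun μ => μ univ) h0
      exact h.exists
    rw [← h0]
    exact (norm_nonneg v).trans hv
  · exact le_of_mul_le_mul_left (by linarith [sq ‖w‖]) h0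

/-- A bounded function on `S` which contracts along some selection of `S` is nonpositive. -/
theorem nonpos_of_forall_exists_le_mul {α : Type*} {S : Set α} {f : α → ℝ} {ρ D : ℝ}
    (hρ0 : 0 ≤ ρ) (hρ1 : ρ < 1) (hD : ∀ x ∈ S, f x ≤ D)
    (h : ∀ x ∈ S, ∃ y ∈ S, f x ≤ ρ * f y) : ∀ x ∈ S, f x ≤ 0 := by
  have key : ∀ n : ℕ, ∀ x ∈ S, f x ≤ ρ ^ n * D := by
    intro n
    induction n with
    | zero => simpa using hD
    | succ n ih =>
      intro x hx
      obtain ⟨y, hy, hxy⟩ := h x hx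
      calc f x ≤ ρ * f y := hxy
        _ ≤ ρ * (ρ ^ n * D) := by gcongr; exact ih y hy
        _ = ρ ^ (n + 1) * D := by ring
  intro x hx
  have hlim : Tendsto (fun n : ℕ => ρ ^ n * D) atTop (𝓝 0) := by
    simpa using (tendsto_pow_atTop_nhds_zero_of_lt_one hρ0 hρ1).mul_const D
  exact ge_of_tendsto' hlim fun n => key n x hx

namespace Piggyback

/-! ### Fixed sets of families of affine contractions -/

section FixSet

variable {X Θ : Type*} [NormedAddCommGroup X] [NormedSpace ℝ X]
  [NormedAddCommGroup Θ] [NormedSpace ℝ Θ]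

theorem blockA_apply_add_blockB_apply (M : X × Θ →L[ℝ] X) (x : X) (v : Θ) :
    blockA M x + blockB M v = M (x, v) := by
  simp [blockA, blockB, ← map_add]

theorem norm_blockB_le (M : X × Θ →L[ℝ] X) : ‖blockB M‖ ≤ ‖M‖ := by
  refine ContinuousLinearMap.opNorm_le_bound _ (norm_nonneg _) fun v => ?_
  simpa [blockB] using M.le_opNorm ((0 : X), v)

/-- The affine map `L ↦ A L + B` attached to `M = [A, B]`, jointly in `M` and `L`. -/
theorem continuous_blockA_comp_add_blockB :
    Continuous fun q : (X × Θ →L[ℝ] X) × (Θ →L[ℝ] X) => (blockA q.1).comp q.2 + blockB q.1 := by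
  unfold blockA blockB
  fun_prop

theorem act_eq_image (𝒥 : Set (X × Θ →L[ℝ] X)) (𝒳 : Set (Θ →L[ℝ] X)) :
    act 𝒥 𝒳 = (fun q : (X × Θ →L[ℝ] X) × (Θ →L[ℝ] X) => (blockA q.1).comp q.2 + blockB q.1) ''
      (𝒥 ×ˢ 𝒳) := by
  ext N
  constructor
  · rintro ⟨M, hM, L, hL, rfl⟩
    exact ⟨(M, L), ⟨hM, hL⟩, rfl⟩
  · rintro ⟨⟨M, L⟩, ⟨hM, hL⟩, rfl⟩
    exact ⟨M, hM, L, hL, rfl⟩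

theorem act_mono (𝒥 : Set (X × Θ →L[ℝ] X)) {S T : Set (Θ →L[ℝ] X)} (h : S ⊆ T) :
    act 𝒥 S ⊆ act 𝒥 T := by
  rintro _ ⟨M, hM, L, hL, rfl⟩
  exact ⟨M, hM, L, h hL, rfl⟩

theorem isCompact_act {𝒥 : Set (X × Θ →L[ℝ] X)} {S : Set (Θ →L[ℝ] X)} (h𝒥 : IsCompact 𝒥)
    (hS : IsCompact S) : IsCompact (act 𝒥 S) := by
  rw [act_eq_image]
  exact (h𝒥.prod hS).image continuous_blockA_comp_add_blockB

variable {𝒥 : Set (X × Θ →L[ℝ] X)} {S K : Set (Θ →L[ℝ] X)} {ρ b : ℝ}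

/-- A bounded set with `S ⊆ 𝒥(S)` lies in the set fixed by `𝒥`. -/
theorem IsFixSet.subset_of_subset_act (hK : IsFixSet 𝒥 K) (hρ0 : 0 ≤ ρ) (hρ1 : ρ < 1)
    (hρ : ∀ M ∈ 𝒥, ‖blockA M‖ ≤ ρ) (hS : Bornology.IsBounded S) (hact : S ⊆ act 𝒥 S) :
    S ⊆ K := by
  obtain ⟨hne, hcomp, heq⟩ := hK
  obtain ⟨L₀, hL₀⟩ := hne
  obtain ⟨D, hD⟩ := hS.subset_closedBall L₀
  have h := nonpos_of_forall_exists_le_mul (S := S) (f := fun L => Metric.infDist L K) hρ0 hρ1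
    (fun L hL => (Metric.infDist_le_dist_of_mem hL₀).trans (hD hL)) ?_
  · intro L hL
    rw [hcomp.isClosed.mem_iff_infDist_zero ⟨L₀, hL₀⟩]
    exact le_antisymm (h L hL) Metric.infDist_nonneg
  · intro L hL
    obtain ⟨M, hM, L', hL', rfl⟩ := hact hL
    refine ⟨L', hL', ?_⟩
    obtain ⟨L'', hL'', hd⟩ := hcomp.exists_infDist_eq_dist ⟨L₀, hL₀⟩ L'
    have hmem : (blockA M).comp L'' + blockB M ∈ K := by
      rw [heq]
      exact ⟨M, hM, L'', hL'', rfl⟩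
    refine (Metric.infDist_le_dist_of_mem hmem).trans ?_
    rw [hd, dist_eq_norm, dist_eq_norm, add_sub_add_right_eq_sub, ← ContinuousLinearMap.comp_sub]
    refine (ContinuousLinearMap.opNorm_comp_le _ _).trans ?_
    gcongr
    exact hρ M hM

theorem IsFixSet.unique {K' : Set (Θ →L[ℝ] X)} (hK : IsFixSet 𝒥 K) (hK' : IsFixSet 𝒥 K')
    (hρ0 : 0 ≤ ρ) (hρ1 : ρ < 1) (hρ : ∀ M ∈ 𝒥, ‖blockA M‖ ≤ ρ) : K = K' :=
  (hK'.subset_of_subset_act hρ0 hρ1 hρ hK.2.1.isBounded hK.2.2.subset).antisymm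
    (hK.subset_of_subset_act hρ0 hρ1 hρ hK'.2.1.isBounded hK'.2.2.subset)

theorem norm_blockA_comp_add_blockB_le {M : X × Θ →L[ℝ] X}
    (hM : ‖blockA M‖ ≤ ρ) (hMb : ‖M‖ ≤ b) (L : Θ →L[ℝ] X) :
    ‖(blockA M).comp L + blockB M‖ ≤ ρ * ‖L‖ + b := by
  refine (norm_add_le _ _).trans (add_le_add ?_ ((norm_blockB_le M).trans hMb))
  refine (ContinuousLinearMap.opNorm_comp_le _ _).trans ?_
  gcongr

/-- The bound `b / (1 - ρ)` is the fixed point of `r ↦ ρ * r + b`, so the excess of `‖L‖` over it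
contracts. -/
theorem norm_le_of_subset_act (hρ0 : 0 ≤ ρ) (hρ1 : ρ < 1) (hρ : ∀ M ∈ 𝒥, ‖blockA M‖ ≤ ρ)
    (hb : ∀ M ∈ 𝒥, ‖M‖ ≤ b) (hS : Bornology.IsBounded S) (hact : S ⊆ act 𝒥 S) :
    ∀ L ∈ S, ‖L‖ ≤ b / (1 - ρ) := by
  obtain ⟨D, hD⟩ := hS.exists_norm_le
  intro L hL
  have h := nonpos_of_forall_exists_le_mul (S := S) (f := fun L => ‖L‖ - b / (1 - ρ)) hρ0 hρ1
    (fun L hL => sub_le_sub_right (hD L hL) _) (fun L hL => ?_) L hL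
  · linarith
  · obtain ⟨M, hM, L', hL', rfl⟩ := hact hL
    refine ⟨L', hL', ?_⟩
    have h1 := norm_blockA_comp_add_blockB_le (hρ M hM) (hb M hM) L'
    have h2 : b / (1 - ρ) * (1 - ρ) = b := div_mul_cancel₀ _ (by linarith)
    linarith

variable [FiniteDimensional ℝ X] [FiniteDimensional ℝ Θ]

/-- A compact set `𝒥` whose blocks `A` are uniform contractions fixes a nonempty compact set: the
largest `T` in a large ball with `T ⊆ 𝒥(T)`. -/
theorem exists_isFixSet (h𝒥 : IsCompact 𝒥) (hne : 𝒥.Nonempty) (hρ0 : 0 ≤ ρ) (hρ1 : ρ < 1)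
    (hρ : ∀ M ∈ 𝒥, ‖blockA M‖ ≤ ρ) : ∃ K, IsFixSet 𝒥 K := by
  obtain ⟨b, hb⟩ := h𝒥.isBounded.exists_norm_le
  set B : Set (Θ →L[ℝ] X) := Metric.closedBall 0 (b / (1 - ρ)) with hB
  have hBb : Bornology.IsBounded B := Metric.isBounded_closedBall
  set T : Set (Θ →L[ℝ] X) := ⋃₀ {S | Bornology.IsBounded S ∧ S ⊆ act 𝒥 S} with hT
  have hmax : ∀ S, Bornology.IsBounded S → S ⊆ act 𝒥 S → S ⊆ T := fun S h1 h2 =>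
    subset_sUnion_of_mem (t := S) ⟨h1, h2⟩
  have hTB : T ⊆ B := sUnion_subset fun S hS L hL => by
    simpa [hB] using norm_le_of_subset_act hρ0 hρ1 hρ hb hS.1 hS.2 L hL
  have hTb : Bornology.IsBounded T := hBb.subset hTB
  have hTact : T ⊆ act 𝒥 T := sUnion_subset fun S hS =>
    hS.2.trans (act_mono 𝒥 (hmax S hS.1 hS.2))
  have hcl : IsCompact (closure T) := hTb.isCompact_closure
  -- The closure also lies in its own image, so maximality makes `T` closed.
  have hclT : closure T ⊆ T := by
    refine hmax _ hcl.isBounded ?_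
    exact closure_minimal (hTact.trans (act_mono 𝒥 subset_closure)) (isCompact_act h𝒥 hcl).isClosed
  have hTc : IsCompact T := by rwa [subset_closure.antisymm hclT]
  refine ⟨T, ?_, hTc, hTact.antisymm (hmax _ (isCompact_act h𝒥 hTc).isBounded (act_mono 𝒥 hTact))⟩
  obtain ⟨M, hM⟩ := hne
  -- Nonemptiness: the fixed point of a single affine map is a singleton competitor.
  have hcontr : ContractingWith ρ.toNNReal
      fun L : Θ →L[ℝ] X => (blockA M).comp L + blockB M := by
    refine ⟨Real.toNNReal_lt_one.2 hρ1, LipschitzWith.of_dist_le_mul fun L L' => ?_⟩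
    rw [dist_eq_norm, dist_eq_norm, add_sub_add_right_eq_sub, ← ContinuousLinearMap.comp_sub,
      Real.coe_toNNReal ρ hρ0]
    refine (ContinuousLinearMap.opNorm_comp_le _ _).trans ?_
    gcongr
    exact hρ M hM
  have hfix : (blockA M).comp hcontr.fixedPoint + blockB M = hcontr.fixedPoint :=
    hcontr.fixedPoint_isFixedPt
  refine ⟨hcontr.fixedPoint, hmax {hcontr.fixedPoint} Bornology.isBounded_singleton ?_ rfl⟩
  exact singleton_subset_iff.2 ⟨M, hM, _, rfl, hfix.symm⟩

theorem existsUnique_isFixSet (h𝒥 : IsCompact 𝒥) (hne : 𝒥.Nonempty) (hρ0 : 0 ≤ ρ) (hρ1 : ρ < 1)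
    (hρ : ∀ M ∈ 𝒥, ‖blockA M‖ ≤ ρ) : ∃! K, IsFixSet 𝒥 K :=
  existsUnique_of_exists_of_unique (exists_isFixSet h𝒥 hne hρ0 hρ1 hρ)
    fun _ _ h1 h2 => h1.unique h2 hρ0 hρ1 hρ

end FixSet

/-! ### Local boundedness and closed graphs -/

section Graph

variable {E G : Type*} [NormedAddCommGroup E] [NormedSpace ℝ E]
  [NormedAddCommGroup G] [NormedSpace ℝ G]

theorem LocallyBounded.exists_norm_le {J : E → Set (E →L[ℝ] G)} (hJ : LocallyBounded J) (x : E) :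
    ∃ b, ∀ᶠ y in 𝓝 x, ∀ M ∈ J y, ‖M‖ ≤ b := by
  obtain ⟨U, hU, hb⟩ := hJ x
  obtain ⟨b, hb⟩ := hb.exists_norm_le
  exact ⟨b, by filter_upwards [hU] with y hy M hM using hb M (mem_biUnion hy hM)⟩

theorem locallyBounded_of_exists_norm_le {J : E → Set (E →L[ℝ] G)}
    (h : ∀ x, ∃ b, ∀ᶠ y in 𝓝 x, ∀ M ∈ J y, ‖M‖ ≤ b) : LocallyBounded J := by
  intro x
  obtain ⟨b, hb⟩ := h x
  refine ⟨_, hb, isBounded_iff_forall_norm_le.2 ⟨b, fun M hM => ?_⟩⟩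
  obtain ⟨y, hy, hM⟩ := mem_iUnion₂.1 hM
  exact hy M hM

theorem IsConservativeJacobian.isCompact [FiniteDimensional ℝ E] [FiniteDimensional ℝ G]
    {f : E → G} {J : E → Set (E →L[ℝ] G)} (hJ : IsConservativeJacobian f J) (x : E) :
    IsCompact (J x) := by
  obtain ⟨b, hb⟩ := hJ.locallyBounded.exists_norm_le x
  refine Metric.isCompact_of_isClosed_isBounded ?_
    (isBounded_iff_forall_norm_le.2 ⟨b, hb.self_of_nhds⟩)
  exact hJ.isClosed_graph.preimage (f := fun M : E →L[ℝ] G => (x, M)) (by fun_prop)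

variable {T X Θ : Type*} [PseudoMetricSpace T] [NormedAddCommGroup X] [NormedSpace ℝ X]
  [NormedAddCommGroup Θ] [NormedSpace ℝ Θ] {ρ : ℝ}
  {J : T → Set (X × Θ →L[ℝ] X)} {K : T → Set (Θ →L[ℝ] X)}

theorem eventually_norm_le_of_isFixSet (hρ0 : 0 ≤ ρ) (hρ1 : ρ < 1)
    (hρ : ∀ t, ∀ M ∈ J t, ‖blockA M‖ ≤ ρ) (hK : ∀ t, IsFixSet (J t) (K t)) {t : T} {b : ℝ}
    (hb : ∀ᶠ s in 𝓝 t, ∀ M ∈ J s, ‖M‖ ≤ b) :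
    ∀ᶠ s in 𝓝 t, ∀ L ∈ K s, ‖L‖ ≤ b / (1 - ρ) := by
  filter_upwards [hb] with s hs
  exact norm_le_of_subset_act hρ0 hρ1 (hρ s) hs (hK s).2.1.isBounded (hK s).2.2.subset

/-- Taking the fixed set preserves closedness of the graph. -/
theorem isClosed_graph_of_isFixSet [FiniteDimensional ℝ X] [FiniteDimensional ℝ Θ]
    (hρ0 : 0 ≤ ρ) (hρ1 : ρ < 1)
    (hρ : ∀ t, ∀ M ∈ J t, ‖blockA M‖ ≤ ρ) (hK : ∀ t, IsFixSet (J t) (K t))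
    (hb : ∀ t, ∃ b, ∀ᶠ s in 𝓝 t, ∀ M ∈ J s, ‖M‖ ≤ b)
    (hJ : IsClosed {q : T × (X × Θ →L[ℝ] X) | q.2 ∈ J q.1}) :
    IsClosed {q : T × (Θ →L[ℝ] X) | q.2 ∈ K q.1} := by
  set Γ := {q : T × (Θ →L[ℝ] X) | q.2 ∈ K q.1} with hΓ
  refine isClosed_of_closure_subset ?_
  rintro ⟨t, L⟩ htL
  obtain ⟨b, hb⟩ := hb t
  have hKb := eventually_norm_le_of_isFixSet hρ0 hρ1 hρ hK hb
  set R := b / (1 - ρ)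
  -- It suffices that the slice at `t` of the closed graph is bounded and contained in its own
  -- image; the latter follows by passing to a limit in the decompositions `A N + B`.
  refine (hK t).subset_of_subset_act (S := {L | (t, L) ∈ closure Γ}) hρ0 hρ1 (hρ t)
    (isBounded_iff_forall_norm_le.2 ⟨R, fun L hL => ?_⟩) (fun L hL => ?_) htL
  · obtain ⟨q, hq, hlim⟩ := mem_closure_iff_seq_limit.1 hL
    rw [Prod.tendsto_iff] at hlim
    refine le_of_tendsto hlim.2.norm ?_
    filter_upwards [hlim.1.eventually hKb] with n hn using hn _ (hq n)
  · obtain ⟨q, hq, hlim⟩ := mem_closure_iff_seq_limit.1 hL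
    rw [Prod.tendsto_iff] at hlim
    have hdec : ∀ n, ∃ r : (X × Θ →L[ℝ] X) × (Θ →L[ℝ] X), r.1 ∈ J (q n).1 ∧ r.2 ∈ K (q n).1 ∧
        (q n).2 = (blockA r.1).comp r.2 + blockB r.1 := by
      intro n
      have h := hq n
      rw [hΓ, mem_ofPred_eq, (hK (q n).1).2.2] at h
      obtain ⟨M, hM, N, hN, h⟩ := h
      exact ⟨(M, N), hM, hN, h⟩
    choose r hrJ hrK hr using hdec
    have hcpt : IsCompact (Metric.closedBall (0 : X × Θ →L[ℝ] X) b ×ˢ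
        Metric.closedBall (0 : Θ →L[ℝ] X) R) :=
      (isCompact_closedBall _ _).prod (isCompact_closedBall _ _)
    have hev : ∀ᶠ n in atTop, r n ∈ Metric.closedBall (0 : X × Θ →L[ℝ] X) b ×ˢ
        Metric.closedBall (0 : Θ →L[ℝ] X) R := by
      filter_upwards [hlim.1.eventually hb, hlim.1.eventually hKb] with n h1 h2
      exact ⟨by simpa using h1 _ (hrJ n), by simpa using h2 _ (hrK n)⟩
    obtain ⟨⟨M, N⟩, -, φ, hφ, hlimr⟩ := hcpt.tendsto_subseq' hev.frequently
    have hlimr' := hlimr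
    rw [Prod.tendsto_iff] at hlimr'
    have hq1 := hlim.1.comp hφ.tendsto_atTop
    refine ⟨M, ?_, N, ?_, ?_⟩
    · exact hJ.mem_of_tendsto (hq1.prodMk_nhds hlimr'.1) (Eventually.of_forall fun n => hrJ (φ n))
    · exact mem_closure_of_tendsto (hq1.prodMk_nhds hlimr'.2)
        (Eventually.of_forall fun n => hrK (φ n))
    · refine tendsto_nhds_unique (hlim.2.comp hφ.tendsto_atTop) ?_
      have h := (continuous_blockA_comp_add_blockB.tendsto (M, N)).comp hlimr
      refine h.congr fun n => ?_
      exact (hr (φ n)).symm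

end Graph

/-! ### Regularity of the fixed-point map -/

section FixedPointMap

variable {X Θ : Type*} [NormedAddCommGroup X] {F : X × Θ → X} {ρ : ℝ}

theorem existsUnique_fixedPoint [CompleteSpace X] (hρ0 : 0 ≤ ρ) (hρ1 : ρ < 1)
    (hF : ∀ θ x y, ‖F (x, θ) - F (y, θ)‖ ≤ ρ * ‖x - y‖) (θ : Θ) : ∃! x, F (x, θ) = x := by
  have hc : ContractingWith ρ.toNNReal fun x => F (x, θ) :=
    ⟨Real.toNNReal_lt_one.2 hρ1, LipschitzWith.of_dist_le_mul fun x y => by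
      simpa [dist_eq_norm, hρ0] using hF θ x y⟩
  exact ⟨hc.fixedPoint, hc.fixedPoint_isFixedPt, fun y hy => hc.fixedPoint_unique hy⟩

/-- The contraction in `x` is absorbed on the left, leaving only the variation of `F` in `θ`. -/
theorem norm_sub_le_of_fixedPoint (hF : ∀ θ x y, ‖F (x, θ) - F (y, θ)‖ ≤ ρ * ‖x - y‖)
    {g : Θ → X} (hg : ∀ θ, F (g θ, θ) = g θ) (θ θ' : Θ) :
    (1 - ρ) * ‖g θ - g θ'‖ ≤ ‖F (g θ', θ) - F (g θ', θ')‖ := by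
  have h1 := hF θ (g θ) (g θ')
  have h2 : g θ - g θ' = (F (g θ, θ) - F (g θ', θ)) + (F (g θ', θ) - F (g θ', θ')) := by
    rw [hg, hg]; abel
  have h3 := norm_add_le (F (g θ, θ) - F (g θ', θ)) (F (g θ', θ) - F (g θ', θ'))
  rw [← h2] at h3
  linarith

variable [NormedAddCommGroup Θ]

theorem continuous_of_fixedPoint (hρ1 : ρ < 1) (hFc : Continuous F)
    (hF : ∀ θ x y, ‖F (x, θ) - F (y, θ)‖ ≤ ρ * ‖x - y‖)
    {g : Θ → X} (hg : ∀ θ, F (g θ, θ) = g θ) : Continuous g := by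
  refine continuous_iff_continuousAt.2 fun θ₀ => ?_
  rw [ContinuousAt, tendsto_iff_norm_sub_tendsto_zero]
  have hlim : Tendsto (fun θ => ‖F (g θ₀, θ) - F (g θ₀, θ₀)‖ / (1 - ρ)) (𝓝 θ₀) (𝓝 0) := by
    have : Continuous fun θ => ‖F (g θ₀, θ) - F (g θ₀, θ₀)‖ / (1 - ρ) := by fun_prop
    simpa using this.tendsto θ₀
  refine squeeze_zero (fun θ => norm_nonneg _) (fun θ => ?_) hlim
  rw [le_div_iff₀ (by linarith), mul_comm]
  exact norm_sub_le_of_fixedPoint hF hg θ θ₀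

theorem locallyLipschitz_of_fixedPoint (hρ1 : ρ < 1) (hFl : LocallyLipschitz F)
    (hF : ∀ θ x y, ‖F (x, θ) - F (y, θ)‖ ≤ ρ * ‖x - y‖)
    {g : Θ → X} (hg : ∀ θ, F (g θ, θ) = g θ) : LocallyLipschitz g := by
  intro θ₀
  -- Continuity comes first: it keeps `g θ` in the neighbourhood where `F` is Lipschitz.
  have hgc := continuous_of_fixedPoint hρ1 hFl.continuous hF hg
  obtain ⟨k, U, hU, hk⟩ := hFl (g θ₀, θ₀)
  obtain ⟨V, hV, W, hW, hVW⟩ := mem_nhds_prod_iff.1 hU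
  refine ⟨k / (1 - ρ).toNNReal, g ⁻¹' V ∩ W,
    inter_mem (hgc.continuousAt.preimage_mem_nhds hV) hW, ?_⟩
  refine LipschitzOnWith.of_dist_le_mul fun θ hθ θ' hθ' => ?_
  have h1 := norm_sub_le_of_fixedPoint hF hg θ θ'
  have h2 := hk.dist_le_mul (g θ', θ) (hVW ⟨hθ'.1, hθ.2⟩) (g θ', θ') (hVW ⟨hθ'.1, hθ'.2⟩)
  rw [Prod.dist_eq, dist_self, max_eq_right dist_nonneg, dist_eq_norm] at h2
  rw [NNReal.coe_div, Real.coe_toNNReal _ (by linarith), div_mul_eq_mul_div, le_div_iff₀ (by linarith), mul_comm,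
    dist_eq_norm]
  exact h1.trans h2

end FixedPointMap

/-! ### Contraction from the Jacobian, and the chain rule -/

section Main

variable {X Θ : Type*} [NormedAddCommGroup X] [InnerProductSpace ℝ X]
  [NormedAddCommGroup Θ] [NormedSpace ℝ Θ] {F : X × Θ → X}
  {JF : X × Θ → Set (X × Θ →L[ℝ] X)} {ρ : ℝ}

theorem IsConservativeJacobian.norm_sub_le (hJF : IsConservativeJacobian F JF)
    (hρ : ∀ z, ∀ M ∈ JF z, ‖blockA M‖ ≤ ρ) (θ : Θ) (x y : X) :
    ‖F (x, θ) - F (y, θ)‖ ≤ ρ * ‖x - y‖ := by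
  set γ : ℝ → X × Θ := fun t => (y + t • (x - y), θ) with hγ
  have hγ' : ∀ t, HasDerivAt γ (x - y, 0) t := fun t =>
    HasDerivAt.prodMk (by simpa using ((hasDerivAt_id t).smul_const (x - y)).const_add y)
      (hasDerivAt_const t θ)
  have hac : AbsolutelyContinuousOnInterval γ 0 1 :=
    ContDiffOn.absolutelyContinuousOnInterval (ContDiff.contDiffOn (by fun_prop))
  have h := (hJF.locallyLipschitz.comp_absolutelyContinuousOnInterval hac)
    |>.norm_sub_le_of_ae_hasDerivAt (C := ρ * ‖x - y‖) ?_
  · simpa [hγ] using h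
  · filter_upwards [hJF.chain_rule γ hac] with t ht
    obtain ⟨M, hM⟩ := hJF.nonempty (γ t)
    refine ⟨_, ht.2 M hM, ?_⟩
    rw [(hγ' t).deriv, ← blockA_apply_add_blockB_apply, map_zero, add_zero]
    exact (blockA M).le_of_opNorm_le (hρ _ M hM) _

/-- If `w = A w + B v` for all `[A, B] ∈ 𝒥`, then `w = L v` for all `L` in the fixed set. -/
theorem IsFixSet.apply_eq {𝒥 : Set (X × Θ →L[ℝ] X)} {K : Set (Θ →L[ℝ] X)}
    (hK : IsFixSet 𝒥 K) (hρ0 : 0 ≤ ρ) (hρ1 : ρ < 1) (hρ : ∀ M ∈ 𝒥, ‖blockA M‖ ≤ ρ)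
    {v : Θ} {w : X} (h : ∀ M ∈ 𝒥, M (w, v) = w) {L : Θ →L[ℝ] X} (hL : L ∈ K) : L v = w := by
  obtain ⟨D, hD⟩ := (hK.2.1.image (f := fun L : Θ →L[ℝ] X => ‖L v - w‖) (by fun_prop)).bddAbove
  have hle := nonpos_of_forall_exists_le_mul (S := K) (f := fun L => ‖L v - w‖) hρ0 hρ1
    (fun L hL => hD (mem_image_of_mem _ hL)) (fun L hL => ?_) L hL
  · exact sub_eq_zero.1 (norm_le_zero_iff.1 hle)
  · rw [hK.2.2] at hL
    obtain ⟨M, hM, L', hL', rfl⟩ := hL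
    refine ⟨L', hL', ?_⟩
    have hw : ((blockA M).comp L' + blockB M) v - w = blockA M (L' v - w) := by
      -- Writing `w = A w + B v` cancels the `B v` terms.
      conv_lhs => rw [← h M hM, ← blockA_apply_add_blockB_apply]
      simp
    simp only [hw]
    exact (blockA M).le_of_opNorm_le (hρ M hM) _

variable [FiniteDimensional ℝ X] [FiniteDimensional ℝ Θ]

theorem IsConservativeJacobian.of_fixedPoint (hJF : IsConservativeJacobian F JF)
    (hρ0 : 0 ≤ ρ) (hρ1 : ρ < 1) (hρ : ∀ z, ∀ M ∈ JF z, ‖blockA M‖ ≤ ρ)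
    {g : Θ → X} (hg : ∀ θ, F (g θ, θ) = g θ) {K : Θ → Set (Θ →L[ℝ] X)}
    (hK : ∀ θ, IsFixSet (JF (g θ, θ)) (K θ)) : IsConservativeJacobian g K := by
  have hF := hJF.norm_sub_le hρ
  have hgl := locallyLipschitz_of_fixedPoint hρ1 hJF.locallyLipschitz hF hg
  have hgc := hgl.continuous
  have hgraph : Continuous fun θ => (g θ, θ) := hgc.prodMk continuous_id
  have hb : ∀ θ, ∃ b, ∀ᶠ θ' in 𝓝 θ, ∀ M ∈ JF (g θ', θ'), ‖M‖ ≤ b := fun θ => by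
    obtain ⟨b, hb⟩ := hJF.locallyBounded.exists_norm_le (g θ, θ)
    exact ⟨b, (hgraph.tendsto θ).eventually hb⟩
  have hρ' : ∀ θ, ∀ M ∈ JF (g θ, θ), ‖blockA M‖ ≤ ρ := fun θ => hρ (g θ, θ)
  refine ⟨hgl, fun θ => (hK θ).1, ?_, ?_, ?_⟩
  · refine isClosed_graph_of_isFixSet hρ0 hρ1 hρ' hK hb ?_
    exact hJF.isClosed_graph.preimage
      (f := fun q : Θ × (X × Θ →L[ℝ] X) => ((g q.1, q.1), q.2)) (by fun_prop)
  · refine locallyBounded_of_exists_norm_le fun θ => ?_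
    obtain ⟨b, hb⟩ := hb θ
    exact ⟨_, eventually_norm_le_of_isFixSet hρ0 hρ1 hρ' hK hb⟩
  · intro γ hγ
    have hac := (hgl.comp_absolutelyContinuousOnInterval hγ).prodMk hγ
    filter_upwards [hJF.chain_rule _ hac] with t ht
    obtain ⟨hd, hV⟩ := ht
    have hd1 : DifferentiableAt ℝ (fun s => g (γ s)) t := hd.fst
    have hd2 : DifferentiableAt ℝ γ t := hd.snd
    refine ⟨hd2, fun L hL => ?_⟩
    rw [(hd1.hasDerivAt.prodMk hd2.hasDerivAt).deriv] at hV
    -- Along the graph `F` returns `g ∘ γ`, so uniqueness of derivatives yields the linear equation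
    -- for every `M`.
    simp only [hg] at hV
    rw [(hK (γ t)).apply_eq hρ0 hρ1 (hρ' (γ t))
      (fun M hM => (hV M hM).unique hd1.hasDerivAt) hL]
    exact hd1.hasDerivAt

end Main

end Piggyback

theorem theorem2 (p m : ℕ)
    (F : EuclideanSpace ℝ (Fin p) × EuclideanSpace ℝ (Fin m) → EuclideanSpace ℝ (Fin p))
    (JF : EuclideanSpace ℝ (Fin p) × EuclideanSpace ℝ (Fin m) →
      Set (EuclideanSpace ℝ (Fin p) × EuclideanSpace ℝ (Fin m) →L[ℝ] EuclideanSpace ℝ (Fin p)))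
    (hJF : Piggyback.IsConservativeJacobian F JF)
    (ρ : ℝ) (hρ0 : 0 ≤ ρ) (hρ1 : ρ < 1)
    (hρ : ∀ z, ∀ M ∈ JF z, ‖Piggyback.blockA M‖ ≤ ρ) :
    -- the fixed-point map is well defined
    (∀ θ, ∃! x, F (x, θ) = x) ∧
    -- the set-valued fixed point is well defined at every parameter
    (∀ θ, IsCompact (JF (Piggyback.fixedPointMap F θ, θ)) ∧
      ∃! K, Piggyback.IsFixSet (JF (Piggyback.fixedPointMap F θ, θ)) K) ∧
    -- it is a conservative Jacobian for the fixed-point map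
    Piggyback.IsConservativeJacobian (Piggyback.fixedPointMap F) (Piggyback.algJacobian F JF) := by
  have hF := hJF.norm_sub_le hρ
  have hfix := Piggyback.existsUnique_fixedPoint hρ0 hρ1 hF
  have hset := fun θ => Piggyback.existsUnique_isFixSet
    (hJF.isCompact (Piggyback.fixedPointMap F θ, θ)) (hJF.nonempty _) hρ0 hρ1 (hρ _)
  exact ⟨hfix, fun θ => ⟨hJF.isCompact _, hset θ⟩,
    hJF.of_fixedPoint hρ0 hρ1 hρ (fun θ => Classical.epsilon_spec (hfix θ).exists)
      fun θ => Classical.epsilon_spec (hset θ).exists⟩
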